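/- A hypergraph $H=(V,E)$ consists of disjoint finite sets $V\neq\emptyset$ (vertices) and $E$ (edges) and an incidence function $\psi:E\to 2^V$; distinct edges may be parallel, that is, have the same image under $\psi$. We write $v\in e$ for $v\in\psi(e)$ and $|e|$ for $|\psi(e)|$. The degree of a vertex $v$ is the number of edges $e\in E$ with $v\in e$. A walk is a sequence $W=v_0e_1v_1e_2\ldots e_kv_k$ ($k\ge 0$) with $v_i\in V$, $e_i\in E$ and, for $1\le i\le k$, $v_{i-1}\ne v_i$ and $v_{i-1},v_i\in e_i$. It is a strict closed trail if $k\ge 2$, $v_0=v_k$ and the edges $e_1,\ldots,e_k$ are pairwise distinct (distinct parallel edges being counted as distinct). The elements of $V\cup E$ that lie on $W$ are the vertices $v_0,\ldots,v_k$ and the edges $e_1,\ldots,e_k$. Two vertices $u,v$ are connected if there is a walk with $v_0=u$ and $v_k=v$; $H$ is connected if every two distinct vertices are connected, and $\omega(H)$ denotes the number of connected components, that is, of equivalence classes of vertices under this relation. A cut edge is an edge $e\in E$ with $\omega(H-e)>\omega(H)$, where $H-e$ has vertex set $V$ and edge set $E\setminus\{e\}$. Theorem. Let $H=(V,E)$ be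 a connected hypergraph with $|V|\ge 2$, without edges of cardinality less than $2$, and without vertices of degree less than $2$. Then the following are equivalent: (1) $H$ has no cut edges. (2) Every pair of distinct elements of $V\cup E$ lie on a common strict closed trail. (3) Every pair of distinct vertices lie on a common strict closed trail. (4) Every pair of distinct edges lie on a common strict closed trail. -/

import Mathlib

/-- A hypergraph with vertex set `V` and edge set `E`, given by its incidence function.
Parallel edges, singleton edges and empty edges are allowed. Finiteness of `V` and `E` is
expressed by `[Finite V] [Finite E]` where it is needed. -/
structure IncHypergraph (V : Type*) (E : Type*) where
  /-- the incidence function -/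
  inc : E → Set V

namespace IncHypergraph

variable {V : Type*} {E : Type*}

/-- The degree of a vertex: the number of edges containing it (parallel edges counted
separately). -/
noncomputable def degree (H : IncHypergraph V E) (v : V) : ℕ :=
  {e : E | v ∈ H.inc e}.ncard

/-- The distinct vertices `u` and `v` are adjacent via the edge `e`. -/
def AdjVia (H : IncHypergraph V E) (e : E) (u v : V) : Prop :=
  u ≠ v ∧ u ∈ H.inc e ∧ v ∈ H.inc e

/-- The edge-deleted hypersubgraph `H - e`: same vertices, the edge `e` removed. -/
def deleteEdge (H : IncHypergraph V E) (e : E) : IncHypergraph V {f : E // f ≠ e} where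
  inc f := H.inc f.1

/-- A `(u, w)`-walk `v₀ e₁ v₁ e₂ … eₖ vₖ`: an alternating sequence of vertices and edges in which
consecutive vertices are adjacent via the edge between them. -/
inductive Walk (H : IncHypergraph V E) : V → V → Type _
  | nil (u : V) : Walk H u u
  | cons {u v w : V} (e : E) (h : H.AdjVia e u v) (p : Walk H v w) : Walk H u w

namespace Walk

variable {H : IncHypergraph V E}

/-- The sequence `v₀, v₁, …, vₖ` of anchors. -/
def anchors {u w : V} : H.Walk u w → List V
  | nil u => [u]
  | @cons _ _ _ u _ _ _ _ p => u :: p.anchors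

/-- The sequence `e₁, …, eₖ` of edges. -/
def edges {u w : V} : H.Walk u w → List E
  | nil _ => []
  | cons e _ p => e :: p.edges

/-- The length `k` of a walk. -/
def length {u w : V} (p : H.Walk u w) : ℕ := p.edges.length

/-- Concatenation of walks. -/
def append {u v w : V} : H.Walk u v → H.Walk v w → H.Walk u w
  | nil _, q => q
  | cons e h p, q => cons e h (p.append q)

/-- The reversed walk. -/
def reverse {u w : V} : H.Walk u w → H.Walk w u
  | nil u => nil u
  | cons e h p => p.reverse.append (cons e ⟨h.1.symm, h.2.2, h.2.1⟩ (nil _))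

/-- A strict trail: the edges `e₁, …, eₖ` are pairwise distinct (distinct parallel edges count as
distinct). -/
def IsStrictTrail {u w : V} (p : H.Walk u w) : Prop := p.edges.Nodup

/-- A strict closed trail: a closed walk (equal endpoints, length at least 2) that is a strict
trail. -/
def IsStrictClosedTrail {u : V} (p : H.Walk u u) : Prop :=
  2 ≤ p.length ∧ p.IsStrictTrail

/-- An element of `V ∪ E` lies on a walk: a vertex as one of the anchors, an edge as one of the
edges of the walk. -/
def Visits {u w : V} (p : H.Walk u w) : V ⊕ E → Prop
  | Sum.inl v => v ∈ p.anchors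
  | Sum.inr e => e ∈ p.edges

end Walk

/-- Two vertices are connected if there is a walk between them. -/
def ConnectedVertices (H : IncHypergraph V E) (u v : V) : Prop := Nonempty (H.Walk u v)

/-- A hypergraph is connected if every pair of distinct vertices is connected. -/
def Connected (H : IncHypergraph V E) : Prop :=
  ∀ u v : V, u ≠ v → H.ConnectedVertices u v

/-- Vertex connection as an equivalence relation. -/
def connectionSetoid (H : IncHypergraph V E) : Setoid V where
  r := H.ConnectedVertices
  iseqv :=
    { refl := fun u => ⟨Walk.nil u⟩
      symm := fun ⟨p⟩ => ⟨p.reverse⟩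
      trans := fun ⟨p⟩ ⟨q⟩ => ⟨p.append q⟩ }

/-- The number `ω(H)` of connected components; these correspond to the equivalence classes of
vertex connection. -/
noncomputable def numComponents (H : IncHypergraph V E) : ℕ :=
  Nat.card (Quotient H.connectionSetoid)

/-- A cut edge: its deletion increases the number of connected components. -/
def IsCutEdge (H : IncHypergraph V E) (e : E) : Prop :=
  H.numComponents < (H.deleteEdge e).numComponents

/-- Two elements of `V ∪ E` lie on a common strict closed trail. -/
def OnCommonStrictClosedTrail (H : IncHypergraph V E) (x y : V ⊕ E) : Prop :=
  ∃ (u : V) (p : H.Walk u u), p.IsStrictClosedTrail ∧ p.Visits x ∧ p.Visits y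

end IncHypergraph

namespace IncHypergraph

variable {V : Type*} {E : Type*} {H : IncHypergraph V E}

/-! For a connected `H`, having no cut edge means that every `H - e` is connected. Fix an element
`x`. The property "on a common strict closed trail with `x`" then passes from a vertex to every edge
containing it (`edge_of_vertex`) and from an edge to all its vertices (`vertex_of_edge`), so it
spreads along walks to everything. Both transfers rest on one rerouting
(`exists_isStrictTrail_to_end`): given a strict trail `t` through `x` avoiding `e`, go in `H - e`
from a vertex of `e` until `t` is first touched, follow `t` past `x` to one of its ends, and close
up through `e`. Conversely, the anchors of a closed trail stay connected when one edge is deleted,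
so (3) and (4) each exclude cut edges. -/

theorem AdjVia.symm {e : E} {u v : V} (h : H.AdjVia e u v) : H.AdjVia e v u :=
  ⟨h.1.symm, h.2.2, h.2.1⟩

/-! ### Walks: concatenation, reversal, splitting -/

namespace Walk

@[simp] theorem edges_nil (u : V) : (nil u : H.Walk u u).edges = [] := rfl

@[simp] theorem edges_cons {u v w : V} (e : E) (h : H.AdjVia e u v) (p : H.Walk v w) :
    (cons e h p).edges = e :: p.edges := rfl

@[simp] theorem edges_append {u v w : V} (p : H.Walk u v) (q : H.Walk v w) :
    (p.append q).edges = p.edges ++ q.edges := by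
  induction p with
  | nil => rfl
  | cons e h p ih => simp [append, ih]

@[simp] theorem edges_reverse {u v : V} (p : H.Walk u v) :
    p.reverse.edges = p.edges.reverse := by
  induction p with
  | nil => rfl
  | cons e h p ih =>
    rw [reverse, edges_append, ih, edges_cons, List.reverse_cons]
    rfl

theorem start_mem_anchors {u v : V} (p : H.Walk u v) : u ∈ p.anchors := by
  cases p <;> simp [anchors]

theorem end_mem_anchors {u v : V} (p : H.Walk u v) : v ∈ p.anchors := by
  induction p with
  | nil => simp [anchors]
  | cons e h p ih => simp [anchors, ih]

theorem mem_anchors_append {u v w z : V} (p : H.Walk u v) (q : H.Walk v w) :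
    z ∈ (p.append q).anchors ↔ z ∈ p.anchors ∨ z ∈ q.anchors := by
  induction p with
  | nil u =>
    simp only [append, anchors, List.mem_singleton]
    exact ⟨Or.inr, fun h => h.elim (fun h => h ▸ q.start_mem_anchors) id⟩
  | cons e h p ih => simp [append, anchors, ih, or_assoc]

theorem mem_anchors_reverse {u v z : V} (p : H.Walk u v) :
    z ∈ p.reverse.anchors ↔ z ∈ p.anchors := by
  induction p with
  | nil => rfl
  | cons e h p ih =>
    have := p.start_mem_anchors
    simp only [reverse, mem_anchors_append, ih, anchors, List.mem_cons, List.not_mem_nil, or_false]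
    constructor
    · rintro (h | rfl | h) <;> simp_all
    · rintro (h | h) <;> simp [h]

theorem visits_append {u v w : V} {x : V ⊕ E} (p : H.Walk u v) (q : H.Walk v w) :
    (p.append q).Visits x ↔ p.Visits x ∨ q.Visits x := by
  cases x
  · exact mem_anchors_append p q
  · simp [Visits]

theorem visits_reverse {u v : V} {x : V ⊕ E} (p : H.Walk u v) :
    p.reverse.Visits x ↔ p.Visits x := by
  cases x
  · exact mem_anchors_reverse p
  · simp [Visits]

theorem visits_cons {u v w : V} {x : V ⊕ E} (e : E) (h : H.AdjVia e u v) (p : H.Walk v w) :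
    (cons e h p).Visits x ↔ x = Sum.inl u ∨ x = Sum.inr e ∨ p.Visits x := by
  cases x <;> simp [Visits, anchors]

theorem exists_append_of_mem_anchors {u v w : V} (p : H.Walk u v) (hw : w ∈ p.anchors) :
    ∃ (q : H.Walk u w) (r : H.Walk w v), p = q.append r := by
  induction p with
  | nil u =>
    obtain rfl : w = u := by simpa [anchors] using hw
    exact ⟨nil _, nil _, rfl⟩
  | @cons a b c e h p ih =>
    obtain rfl | hw : w = a ∨ w ∈ p.anchors := by simpa [anchors] using hw
    · exact ⟨nil _, cons e h p, rfl⟩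
    · obtain ⟨q, r, rfl⟩ := ih hw
      exact ⟨cons e h q, r, rfl⟩

theorem exists_append_of_mem_edges {u v : V} {g : E} (p : H.Walk u v) (hg : g ∈ p.edges) :
    ∃ (a b : V) (q : H.Walk u a) (h : H.AdjVia g a b) (r : H.Walk b v),
      p = q.append (cons g h r) := by
  induction p with
  | nil u => simp at hg
  | @cons a b c e h p ih =>
    obtain rfl | hg := List.mem_cons.1 hg
    · exact ⟨a, b, nil _, h, p, rfl⟩
    · obtain ⟨a', b', q, h', r, rfl⟩ := ih hg
      exact ⟨a', b', cons e h q, h', r, rfl⟩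

/-! ### Strict trails: shortening, merging, closing, cutting -/

/-- A vertex touches a walk if it is an anchor of it or belongs to one of its edges. -/
def Touches {u v : V} (p : H.Walk u v) (r : V) : Prop :=
  r ∈ p.anchors ∨ ∃ g ∈ p.edges, r ∈ H.inc g

/-- Every walk contains a strict trail with the same ends. -/
theorem exists_isStrictTrail {u v : V} (p : H.Walk u v) :
    ∃ q : H.Walk u v, q.IsStrictTrail ∧ q.edges ⊆ p.edges := by
  induction p with
  | nil u => exact ⟨nil u, List.nodup_nil, fun _ h => h⟩
  | @cons a b c e h p ih =>
    obtain ⟨q, hq, hs⟩ := ih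
    by_cases he : e ∈ q.edges
    · obtain ⟨a', b', q₁, h', q₂, rfl⟩ := q.exists_append_of_mem_edges he
      simp only [IsStrictTrail, edges_append, edges_cons] at hq hs
      have hq₂ : (e :: q₂.edges).Nodup := (List.nodup_append.1 hq).2.1
      have hs₂ : q₂.edges ⊆ p.edges := fun f hf => hs (by simp [hf])
      by_cases hab : a = b'
      · subst hab
        exact ⟨q₂, (List.nodup_cons.1 hq₂).2, fun f hf => List.mem_cons_of_mem _ (hs₂ hf)⟩
      -- Both `a` and `b'` lie in `e`, so one use of `e` skips everything up to its later
      -- occurrence.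
      · exact ⟨cons e ⟨hab, h.2.1, h'.2.2⟩ q₂, hq₂, List.cons_subset_cons _ hs₂⟩
    · exact ⟨cons e h q, List.nodup_cons.2 ⟨he, hq⟩, List.cons_subset_cons _ hs⟩

/-- A strict trail leading to a vertex that touches `t` has an initial part that is edge-disjoint
from `t` and ends in a vertex touching `t`. -/
theorem IsStrictTrail.exists_disjoint_touches {b c : V} (t : H.Walk b c) {u v : V}
    {p : H.Walk u v} (hp : p.IsStrictTrail) (hv : t.Touches v) :
    ∃ (r : V) (q : H.Walk u r), q.IsStrictTrail ∧ q.edges ⊆ p.edges ∧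
      List.Disjoint q.edges t.edges ∧ t.Touches r := by
  induction p with
  | nil u => exact ⟨u, nil u, List.nodup_nil, fun _ h => h, by simp, hv⟩
  | @cons a b c g h p ih =>
    obtain ⟨hgp, hp⟩ := List.nodup_cons.1 hp
    by_cases hg : g ∈ t.edges
    -- The next edge already belongs to `t` and contains `a`, so the initial part stops here.
    · exact ⟨a, nil a, List.nodup_nil, by simp, by simp, Or.inr ⟨g, hg, h.2.1⟩⟩
    · obtain ⟨r, q, hq, hs, hd, hr⟩ := ih hp hv
      exact ⟨r, cons g h q, List.nodup_cons.2 ⟨fun hgq => hgp (hs hgq), hq⟩,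
        List.cons_subset_cons _ hs, by simp [hg, hd], hr⟩

/-- From a vertex touching a strict trail `t`, one can follow `t` in one of the two directions so
as to meet a prescribed element of `t`. -/
theorem IsStrictTrail.exists_of_touches {b c r : V} {x : V ⊕ E} {t : H.Walk b c}
    (ht : t.IsStrictTrail) (hx : t.Visits x) (hr : t.Touches r) :
    ∃ (d : V) (q : H.Walk r d), (d = b ∨ d = c) ∧ q.IsStrictTrail ∧ q.edges ⊆ t.edges ∧
      q.Visits x := by
  by_cases hra : r ∈ t.anchors
  · obtain ⟨t₁, t₂, rfl⟩ := t.exists_append_of_mem_anchors hra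
    simp only [IsStrictTrail, edges_append, List.nodup_append] at ht
    obtain hx | hx := (visits_append t₁ t₂).1 hx
    · exact ⟨b, t₁.reverse, Or.inl rfl, by simpa [IsStrictTrail] using ht.1,
        fun f hf => by simp_all, (visits_reverse _).2 hx⟩
    · exact ⟨c, t₂, Or.inr rfl, ht.2.1, fun f hf => by simp [hf], hx⟩
  -- Here `r` is no anchor but lies in an edge `g` of `t`: entering `t` through `g`, one may leave
  -- at either end of `g` and so choose the direction.
  · obtain ⟨g, hg, hrg⟩ := hr.resolve_left hra
    obtain ⟨p, q, t₁, h, t₂, rfl⟩ := t.exists_append_of_mem_edges hg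
    have hrp : r ≠ p := by
      rintro rfl
      exact hra ((mem_anchors_append _ _).2 (Or.inl t₁.end_mem_anchors))
    have hrq : r ≠ q := by
      rintro rfl
      exact hra ((mem_anchors_append _ _).2
        (Or.inr (List.mem_cons_of_mem _ t₂.start_mem_anchors)))
    simp only [IsStrictTrail, edges_append, edges_cons, List.nodup_append, List.nodup_cons] at ht
    have key : t₁.Visits x ∨ x = Sum.inr g ∨ t₂.Visits x := by
      rw [visits_append, visits_cons] at hx
      obtain hx | rfl | hx := hx
      · exact Or.inl hx
      · exact Or.inl t₁.end_mem_anchors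
      · exact Or.inr hx
    obtain hx | hx := key
    · refine ⟨b, cons g ⟨hrp, hrg, h.2.1⟩ t₁.reverse, Or.inl rfl, ?_, fun f hf => ?_, ?_⟩
      · change (g :: t₁.reverse.edges).Nodup
        rw [edges_reverse, List.nodup_cons, List.mem_reverse, List.nodup_reverse]
        exact ⟨fun hgt => ht.2.2 g hgt g (by simp) rfl, ht.1⟩
      · change f ∈ g :: t₁.reverse.edges at hf
        rw [edges_reverse, List.mem_cons, List.mem_reverse] at hf
        simp only [edges_append, edges_cons, List.mem_append, List.mem_cons]
        tauto
      · exact (visits_cons _ _ _).2 (Or.inr (Or.inr ((visits_reverse _).2 hx)))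
    · exact ⟨c, cons g ⟨hrq, hrg, h.2.2⟩ t₂, Or.inr rfl, List.nodup_cons.2 ht.2.1,
        fun f hf => by rw [edges_append]; exact List.mem_append_right _ hf,
        (visits_cons _ _ _).2 (Or.inr hx)⟩

/-- A strict trail joining two vertices of an edge not on it closes up. -/
theorem IsStrictTrail.isStrictClosedTrail_cons {u v : V} {e : E} {p : H.Walk v u}
    (hp : p.IsStrictTrail) (he : e ∉ p.edges) (h : H.AdjVia e u v) :
    (cons e h p).IsStrictClosedTrail := by
  refine ⟨?_, List.nodup_cons.2 ⟨he, hp⟩⟩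
  cases p with
  | nil => exact absurd rfl h.1
  | cons f h' p => simp [length]

/-- A closed trail can be started at any of its anchors. -/
theorem IsStrictClosedTrail.rotate {u w : V} {p : H.Walk u u} (hp : p.IsStrictClosedTrail)
    (hw : w ∈ p.anchors) :
    ∃ q : H.Walk w w, q.IsStrictTrail ∧ ∀ x, q.Visits x ↔ p.Visits x := by
  obtain ⟨p₁, p₂, rfl⟩ := p.exists_append_of_mem_anchors hw
  refine ⟨p₂.append p₁, ?_, fun x => ?_⟩
  · have := hp.2
    simp only [IsStrictTrail, edges_append] at this ⊢
    exact List.nodup_append_comm.1 this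
  · rw [visits_append, visits_append, or_comm]

/-- A closed trail can be cut open at any of its edges. -/
theorem IsStrictClosedTrail.cut {u : V} {e : E} {p : H.Walk u u} (hp : p.IsStrictClosedTrail)
    (he : e ∈ p.edges) :
    ∃ (a b : V) (_ : H.AdjVia e a b) (q : H.Walk b a), q.IsStrictTrail ∧ e ∉ q.edges ∧
      ∀ x, p.Visits x → x = Sum.inr e ∨ q.Visits x := by
  obtain ⟨a, b, p₁, h, p₂, rfl⟩ := p.exists_append_of_mem_edges he
  have hn : (e :: (p₂.edges ++ p₁.edges)).Nodup := by
    have := hp.2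
    simp only [IsStrictTrail, edges_append] at this
    simpa using List.nodup_append_comm.1 this
  obtain ⟨hn₁, hn₂⟩ := List.nodup_cons.1 hn
  refine ⟨a, b, h, p₂.append p₁, by simpa [IsStrictTrail] using hn₂, by simpa using hn₁,
    fun x hx => ?_⟩
  rw [visits_append, visits_cons] at hx
  rw [visits_append]
  obtain hx | rfl | hx | hx := hx
  · exact Or.inr (Or.inr hx)
  · exact Or.inr (Or.inr p₁.end_mem_anchors)
  · exact Or.inl hx
  · exact Or.inr (Or.inl hx)

theorem exists_anchor_of_mem_edges {u v : V} {f : E} (p : H.Walk u v) (hf : f ∈ p.edges) :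
    ∃ c ∈ p.anchors, c ∈ H.inc f := by
  obtain ⟨a, b, q, h, r, rfl⟩ := p.exists_append_of_mem_edges hf
  exact ⟨a, (mem_anchors_append _ _).2 (Or.inl q.end_mem_anchors), h.2.1⟩

end Walk

open Walk

/-! ### Connection, cut edges and edge deletion -/

theorem ConnectedVertices.symm {u v : V} (h : H.ConnectedVertices u v) :
    H.ConnectedVertices v u :=
  h.map Walk.reverse

theorem ConnectedVertices.trans {u v w : V} (h : H.ConnectedVertices u v)
    (h' : H.ConnectedVertices v w) : H.ConnectedVertices u w :=
  h.elim fun p => h'.map p.append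

theorem connectedVertices_of_mem {e : E} {u v : V} (hu : u ∈ H.inc e) (hv : v ∈ H.inc e) :
    H.ConnectedVertices u v := by
  by_cases h : u = v
  · subst h
    exact ⟨nil u⟩
  · exact ⟨cons e ⟨h, hu, hv⟩ (nil v)⟩

theorem exists_walk_of_deleteEdge {e : E} {u v : V} (p : (H.deleteEdge e).Walk u v) :
    ∃ q : H.Walk u v, e ∉ q.edges := by
  induction p with
  | nil u => exact ⟨nil u, by simp⟩
  | cons f h p ih =>
    obtain ⟨q, hq⟩ := ih
    exact ⟨cons f.1 h q, fun he => (List.mem_cons.1 he).elim f.2.symm hq⟩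

theorem connectedVertices_deleteEdge {e : E} {u v w : V} (p : H.Walk u v) (he : e ∉ p.edges)
    (hw : w ∈ p.anchors) : (H.deleteEdge e).ConnectedVertices u w := by
  induction p with
  | nil u =>
    obtain rfl : w = u := by simpa [anchors] using hw
    exact ⟨nil w⟩
  | @cons a b c f h p ih =>
    simp only [edges_cons, List.mem_cons, not_or] at he
    obtain rfl | hw : w = a ∨ w ∈ p.anchors := by simpa [anchors] using hw
    · exact ⟨nil w⟩
    · exact (ih he.2 hw).map (cons (H := H.deleteEdge e) ⟨f, fun hf => he.1 hf.symm⟩ h)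

theorem numComponents_eq_one [Finite V] [Nonempty V] (h : H.Connected) : H.numComponents = 1 := by
  rw [numComponents, Nat.card_eq_one_iff_unique]
  refine ⟨⟨fun a b => ?_⟩, ‹Nonempty V›.map (Quotient.mk _)⟩
  induction a, b using Quotient.inductionOn₂ with
  | h u v =>
    refine Quotient.sound ?_
    by_cases huv : u = v
    · exact huv ▸ H.connectionSetoid.refl u
    · exact h u v huv

theorem isCutEdge_iff [Finite V] [Nonempty V] (h : H.Connected) (e : E) :
    H.IsCutEdge e ↔ ∃ u v, ¬ (H.deleteEdge e).ConnectedVertices u v := by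
  rw [IsCutEdge, numComponents_eq_one h, numComponents, Finite.one_lt_card_iff_nontrivial]
  constructor
  · rintro ⟨a, b, hab⟩
    induction a, b using Quotient.inductionOn₂ with
    | h u v => exact ⟨u, v, fun huv => hab (Quotient.sound huv)⟩
  · rintro ⟨u, v, huv⟩
    exact ⟨Quotient.mk _ u, Quotient.mk _ v, fun h => huv (Quotient.exact h)⟩

/-- If `e` is on the closed trail, cutting there leaves a walk through all the anchors that avoids
`e`. -/
theorem Walk.IsStrictClosedTrail.connectedVertices_deleteEdge {z u v : V} {p : H.Walk z z}
    (hp : p.IsStrictClosedTrail) (e : E) (hu : u ∈ p.anchors) (hv : v ∈ p.anchors) :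
    (H.deleteEdge e).ConnectedVertices u v := by
  by_cases he : e ∈ p.edges
  · obtain ⟨a, b, -, q, -, heq, hq⟩ := hp.cut he
    have hq' : ∀ w ∈ p.anchors, w ∈ q.anchors := fun w hw =>
      (hq (Sum.inl w) hw).resolve_left (by simp)
    exact (IncHypergraph.connectedVertices_deleteEdge q heq (hq' u hu)).symm.trans
      (IncHypergraph.connectedVertices_deleteEdge q heq (hq' v hv))
  · exact (IncHypergraph.connectedVertices_deleteEdge p he hu).symm.trans
      (IncHypergraph.connectedVertices_deleteEdge p he hv)

/-! ### Rerouting closed trails when `H - e` is connected -/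

/-- If `H - e` is connected, then every vertex is joined to an end of a given strict trail avoiding
`e` by a strict trail that avoids `e` and meets a prescribed element of the given one. -/
theorem exists_isStrictTrail_to_end {e : E}
    (hc : ∀ u v, (H.deleteEdge e).ConnectedVertices u v) {b c : V} {x : V ⊕ E} {t : H.Walk b c}
    (ht : t.IsStrictTrail) (het : e ∉ t.edges) (hx : t.Visits x) (a : V) :
    ∃ (d : V) (q : H.Walk a d), (d = b ∨ d = c) ∧ q.IsStrictTrail ∧ e ∉ q.edges ∧ q.Visits x := by
  obtain ⟨p₀⟩ := hc a b
  obtain ⟨p₁, hp₁⟩ := exists_walk_of_deleteEdge p₀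
  obtain ⟨p, hp, hpp⟩ := p₁.exists_isStrictTrail
  -- Stopping on contact with `t` makes `q₁` edge-disjoint from `t`, so continuing along `t` repeats
  -- no edge.
  obtain ⟨r, q₁, hq₁, hs₁, hd, hr⟩ :=
    hp.exists_disjoint_touches t (Or.inl t.start_mem_anchors)
  obtain ⟨d, q₂, hd₂, hq₂, hs₂, hx₂⟩ := ht.exists_of_touches hx hr
  refine ⟨d, q₁.append q₂, hd₂, ?_, ?_, (visits_append _ _).2 (Or.inr hx₂)⟩
  · simp only [IsStrictTrail, edges_append]
    exact List.Nodup.append hq₁ hq₂ fun f h₁ h₂ => hd h₁ (hs₂ h₂)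
  · simp only [edges_append, List.mem_append, not_or]
    exact ⟨fun h => hp₁ (hpp (hs₁ h)), fun h => het (hs₂ h)⟩

theorem exists_adjVia {e : E} {v : V} (he : 2 ≤ (H.inc e).ncard) (hv : v ∈ H.inc e) :
    ∃ a, H.AdjVia e v a := by
  obtain ⟨a, ha, hav⟩ := Set.exists_ne_of_one_lt_ncard he v
  exact ⟨a, hav.symm, hv, ha⟩

/-- A closed strict trail (possibly trivial) at `v` can be rerouted through an edge `e ∋ v`. -/
theorem exists_closed_through_edge {e : E}
    (hc : ∀ u v, (H.deleteEdge e).ConnectedVertices u v) (he : 2 ≤ (H.inc e).ncard) {v : V}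
    (hv : v ∈ H.inc e) {x : V ⊕ E} {t : H.Walk v v} (ht : t.IsStrictTrail) (het : e ∉ t.edges)
    (hx : t.Visits x) : H.OnCommonStrictClosedTrail x (Sum.inr e) := by
  obtain ⟨a, ha⟩ := exists_adjVia he hv
  obtain ⟨d, q, hd, hq, heq, hxq⟩ := exists_isStrictTrail_to_end hc ht het hx a
  obtain rfl : d = v := hd.elim id id
  exact ⟨d, cons e ha q, hq.isStrictClosedTrail_cons heq ha,
    (visits_cons _ _ _).2 (Or.inr (Or.inr hxq)),
    (visits_cons _ _ _).2 (Or.inr (Or.inl rfl))⟩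

theorem OnCommonStrictClosedTrail.edge_of_vertex {e : E} {v : V} {x : V ⊕ E}
    (hc : ∀ u v, (H.deleteEdge e).ConnectedVertices u v) (he : 2 ≤ (H.inc e).ncard)
    (hv : v ∈ H.inc e) (h : H.OnCommonStrictClosedTrail x (Sum.inl v)) :
    H.OnCommonStrictClosedTrail x (Sum.inr e) := by
  obtain ⟨u, p, hp, hx, hvp⟩ := h
  by_cases hep : e ∈ p.edges
  · exact ⟨u, p, hp, hx, hep⟩
  · obtain ⟨q, hq, hqp⟩ := hp.rotate hvp
    exact exists_closed_through_edge hc he hv hq (fun h => hep ((hqp (Sum.inr e)).1 h))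
      ((hqp x).2 hx)

/-- Cut the trail at `e` to get `t`, reroute from `v` to an end of `t`, and return to `v` through
`e`, which contains both. -/
theorem OnCommonStrictClosedTrail.vertex_of_edge {e : E} {v : V} {x : V ⊕ E}
    (hc : ∀ u v, (H.deleteEdge e).ConnectedVertices u v)
    (hv : v ∈ H.inc e) (h : H.OnCommonStrictClosedTrail x (Sum.inr e)) :
    H.OnCommonStrictClosedTrail x (Sum.inl v) := by
  obtain ⟨u, p, hp, hx, hep⟩ := h
  by_cases hvp : v ∈ p.anchors
  · exact ⟨u, p, hp, hx, hvp⟩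
  obtain ⟨a, b, hab, t, ht, het, hpt⟩ := hp.cut hep
  -- The auxiliary `y` covers `x = e`: that edge is not on `t`, but the closing step visits it, so
  -- any `y` on `t` will do.
  have close : ∀ y, t.Visits y → x = y ∨ x = Sum.inr e →
      H.OnCommonStrictClosedTrail x (Sum.inl v) := by
    intro y hy hxy
    by_cases hvab : v = a ∨ v = b
    · have hvt : v ∈ t.anchors := by
        rcases hvab with rfl | rfl
        exacts [t.end_mem_anchors, t.start_mem_anchors]
      refine ⟨a, cons e hab t, ht.isStrictClosedTrail_cons het hab, ?_,
        (visits_cons _ _ _).2 (Or.inr (Or.inr hvt))⟩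
      rw [visits_cons]
      rcases hxy with rfl | rfl
      exacts [Or.inr (Or.inr hy), Or.inr (Or.inl rfl)]
    obtain ⟨d, q, hd, hq, heq, hyq⟩ := exists_isStrictTrail_to_end hc ht het hy v
    have hdv : H.AdjVia e d v := by
      rcases hd with rfl | rfl
      exacts [⟨fun h => hvab (Or.inr h.symm), hab.2.2, hv⟩,
        ⟨fun h => hvab (Or.inl h.symm), hab.2.1, hv⟩]
    refine ⟨d, cons e hdv q, hq.isStrictClosedTrail_cons heq hdv, ?_,
      (visits_cons _ _ _).2 (Or.inr (Or.inr q.start_mem_anchors))⟩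
    rw [visits_cons]
    rcases hxy with rfl | rfl
    exacts [Or.inr (Or.inr hyq), Or.inr (Or.inl rfl)]
  obtain rfl | hxt := hpt x hx
  · exact close (Sum.inl b) t.start_mem_anchors (Or.inr rfl)
  · exact close x hxt (Or.inl rfl)

/-- If no edge deletion disconnects, any two elements lie on a common strict closed trail. -/
theorem onCommonStrictClosedTrail_of_deleteEdge_connected
    (hc : ∀ (e : E) (u v : V), (H.deleteEdge e).ConnectedVertices u v)
    (hconn : H.Connected) (hedge : ∀ e : E, 2 ≤ (H.inc e).ncard)
    (hinc : ∀ v : V, ∃ e, v ∈ H.inc e) (x y : V ⊕ E) : H.OnCommonStrictClosedTrail x y := by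
  have hne : ∀ e, ∃ v, v ∈ H.inc e := fun e =>
    Set.nonempty_of_ncard_ne_zero (by have := hedge e; omega)
  have step : ∀ {u v : V}, H.Walk u v → H.OnCommonStrictClosedTrail x (Sum.inl u) →
      H.OnCommonStrictClosedTrail x (Sum.inl v) := by
    intro u v p
    induction p with
    | nil => exact id
    | cons e h p ih =>
      exact fun hu => ih ((hu.edge_of_vertex (hc e) (hedge e) h.2.1).vertex_of_edge (hc e) h.2.2)
  have base : ∃ w, H.OnCommonStrictClosedTrail x (Sum.inl w) := by
    cases x with
    | inl v =>
      obtain ⟨e, he⟩ := hinc v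
      -- The trivial trail at `v` starts the process: rerouting it through `e` gives a genuine
      -- closed trail.
      exact ⟨v, (exists_closed_through_edge (hc e) (hedge e) he (t := nil v) List.nodup_nil
        (by simp) (by simp [Visits, anchors])).vertex_of_edge (hc e) he⟩
    | inr e =>
      obtain ⟨v, hv⟩ := hne e
      obtain ⟨u, p, hp, -, hep⟩ := exists_closed_through_edge (x := Sum.inl v) (hc e) (hedge e) hv
        (t := nil v) List.nodup_nil (by simp) (by simp [Visits, anchors])
      exact ⟨u, u, p, hp, hep, p.start_mem_anchors⟩
  obtain ⟨w, hw⟩ := base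
  have all : ∀ v, H.OnCommonStrictClosedTrail x (Sum.inl v) := by
    intro v
    by_cases h : w = v
    · exact h ▸ hw
    · exact (hconn w v h).elim fun p => step p hw
  cases y with
  | inl v => exact all v
  | inr e =>
    obtain ⟨v, hv⟩ := hne e
    exact (all v).edge_of_vertex (hc e) (hedge e) hv

end IncHypergraph

/-! ### The equivalences -/

open IncHypergraph in
theorem mainTheorem8 {V : Type*} {E : Type*} [Finite V] [Finite E] (H : IncHypergraph V E)
    (hconn : H.Connected) (hV : 2 ≤ Nat.card V)
    (hedge : ∀ e : E, 2 ≤ (H.inc e).ncard) (hdeg : ∀ v : V, 2 ≤ H.degree v) :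
    List.TFAE [
      ¬ ∃ e : E, H.IsCutEdge e,
      ∀ x y : V ⊕ E, x ≠ y → H.OnCommonStrictClosedTrail x y,
      ∀ u v : V, u ≠ v → H.OnCommonStrictClosedTrail (Sum.inl u) (Sum.inl v),
      ∀ e f : E, e ≠ f → H.OnCommonStrictClosedTrail (Sum.inr e) (Sum.inr f)] := by
  have : Nonempty V := (Nat.card_pos_iff.1 (by omega)).1
  have hinc : ∀ v e, ∃ f, f ≠ e ∧ v ∈ H.inc f := fun v e => by
    obtain ⟨f, hf, hfe⟩ := Set.exists_ne_of_one_lt_ncard (hdeg v) e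
    exact ⟨f, hfe, hf⟩
  tfae_have 1 → 2 := by
    intro h x y _
    refine onCommonStrictClosedTrail_of_deleteEdge_connected (fun e u v => ?_) hconn hedge
      (fun v => ?_) x y
    · by_contra huv
      exact h ⟨e, (isCutEdge_iff hconn e).2 ⟨u, v, huv⟩⟩
    · exact Set.nonempty_of_ncard_ne_zero (s := {e | v ∈ H.inc e})
        (by have := hdeg v; rw [degree] at this; omega)
  tfae_have 2 → 3 := fun h u v huv => h _ _ (by simpa using huv)
  tfae_have 2 → 4 := fun h e f hef => h _ _ (by simpa using hef)
  tfae_have 3 → 1 := by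
    rintro h ⟨e, he⟩
    obtain ⟨u, v, huv⟩ := (isCutEdge_iff hconn e).1 he
    have hne : u ≠ v := by
      rintro rfl
      exact huv ⟨Walk.nil u⟩
    obtain ⟨z, p, hp, hup, hvp⟩ := h u v hne
    exact huv (hp.connectedVertices_deleteEdge e hup hvp)
  tfae_have 4 → 1 := by
    rintro h ⟨e, he⟩
    obtain ⟨u, v, huv⟩ := (isCutEdge_iff hconn e).1 he
    -- Degree at least 2 gives edges other than `e` at `u` and at `v`; both survive in `H - e` and
    -- tie `u` and `v` to anchors of a closed trail through them.
    obtain ⟨f, hfe, huf⟩ := hinc u e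
    obtain ⟨g, hge, hvg⟩ := hinc v e
    have hmem : ∀ {f : E} (_ : f ≠ e) {a b : V}, a ∈ H.inc f → b ∈ H.inc f →
        (H.deleteEdge e).ConnectedVertices a b := fun {f} hf {a b} ha hb =>
      connectedVertices_of_mem (H := H.deleteEdge e) (e := ⟨f, hf⟩) ha hb
    have hfg : f ≠ g := by
      rintro rfl
      exact huv (hmem hfe huf hvg)
    obtain ⟨z, p, hp, hfp, hgp⟩ := h f g hfg
    obtain ⟨a, hap, haf⟩ := p.exists_anchor_of_mem_edges hfp
    obtain ⟨b, hbp, hbg⟩ := p.exists_anchor_of_mem_edges hgp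
    exact huv ((hmem hfe huf haf).trans
      ((hp.connectedVertices_deleteEdge e hap hbp).trans (hmem hge hbg hvg)))
  tfae_finish
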